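/- On real polynomials let $\langle p,q\rangle=\int_{\mathbb R}p(x)q(x)e^{-x^4}\,dx$ and, for $M_0,M_1\ge 0$, let $\langle p,q\rangle_1=\langle p,q\rangle+M_0\,p(0)q(0)+M_1\,p'(0)q'(0)$. Let $\{F_m\}_{m\ge0}$ and $\{Q_m\}_{m\ge0}$ be the monic orthogonal polynomials with respect to $\langle\cdot,\cdot\rangle$ and $\langle\cdot,\cdot\rangle_1$ respectively ($Q_m$ depends on $M_0,M_1$). Let $K_m(x,y)=\sum_{i=0}^m F_i(x)F_i(y)/\langle F_i,F_i\rangle$, let $K_m^{(j,k)}=\partial_x^j\partial_y^kK_m$, and for $n\ge 1$ put $$J_{2n+1}(x)=F_{2n+1}(x)-\frac{F_{2n+1}'(0)}{K_{2n-1}^{(1,1)}(0,0)}\,K_{2n-1}^{(0,1)}(x,0).$$ Fix $n\ge1$ and $M_0\ge0$. Then $J_{2n+1}=\lim_{M_1\to\infty}Q_{2n+1}$ (coefficientwise). The polynomial $F_{2n+1}$ has exactly $n$ positive zeros $x_1<\dots<x_n$; for every $M_1\ge 0$, $Q_{2n+1}$ has exactly $n$ positive zeros $\eta_1(M_1)<\dots<\eta_n(M_1)$;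 and $J_{2n+1}$ has exactly $n$ distinct zeros $y_1<\dots<y_n$ in $[0,\infty)$. For every $M_1>0$, with $\eta_k=\eta_k(M_1)$, $$0=y_1<\eta_1<x_1<y_2<\eta_2<x_2<\dots<y_n<\eta_n<x_n .$$ For each $k=1,\dots,n$ the function $M_1\mapsto\eta_k(M_1)$ is strictly decreasing on $[0,\infty)$ and $\lim_{M_1\to\infty}\eta_k(M_1)=y_k$. For $2\le k\le n$, $$\lim_{M_1\to\infty}M_1\,[\eta_k(M_1)-y_k]=\frac{-F_{2n+1}(y_k)}{K_{2n-1}^{(1,1)}(0,0)\,J_{2n+1}'(y_k)},$$ where the denominator is nonzero. For $k=1$, where $y_1=0$ and $F_{2n+1}(y_1)=J_{2n+1}'(y_1)=0$, one has $M_1[\eta_1(M_1)-y_1]\to+\infty$ and $$\lim_{M_1\to\infty}M_1\,\eta_1(M_1)^2=\frac{-6\,F_{2n+1}'(0)}{K_{2n-1}^{(1,1)}(0,0)\,J_{2n+1}'''(0)},$$ where again the denominator is nonzero. -/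

import Mathlib

open Polynomial MeasureTheory Filter Topology

noncomputable section

/-! ### Monic orthogonal polynomials of a bilinear form -/

/-- `P` is a sequence of monic orthogonal polynomials for the bilinear form `B`:
`P n` is monic of degree `n`, and the `P n` are pairwise orthogonal with nonzero norms. -/
structure IsMonicOrthogonalSeq (B : LinearMap.BilinForm ℝ ℝ[X]) (P : ℕ → ℝ[X]) : Prop where
  monic : ∀ n, (P n).Monic
  natDegree_eq : ∀ n, (P n).natDegree = n
  orthogonal : ∀ m n, m ≠ n → B (P m) (P n) = 0
  norm_ne_zero : ∀ n, B (P n) (P n) ≠ 0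

/-- The monic orthogonal polynomials of a symmetric, positive definite form `B`, obtained from the
monomials by the Gram-Schmidt process (see `isMonicOrthogonalSeq_monicOrthogonal` and
`IsMonicOrthogonalSeq.eq_monicOrthogonal`). -/
def monicOrthogonal (B : LinearMap.BilinForm ℝ ℝ[X]) (n : ℕ) : ℝ[X] :=
  X ^ n - ∑ k : Fin n,
    C (B (X ^ n) (monicOrthogonal B k) / B (monicOrthogonal B k) (monicOrthogonal B k)) *
      monicOrthogonal B k
termination_by n
decreasing_by exact k.2

theorem monicOrthogonal_eq (B : LinearMap.BilinForm ℝ ℝ[X]) (n : ℕ) :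
    monicOrthogonal B n = X ^ n - ∑ k : Fin n,
      C (B (X ^ n) (monicOrthogonal B k) / B (monicOrthogonal B k) (monicOrthogonal B k)) *
        monicOrthogonal B k := by
  rw [monicOrthogonal]

theorem monicOrthogonal_monic_natDegree (B : LinearMap.BilinForm ℝ ℝ[X]) (n : ℕ) :
    (monicOrthogonal B n).Monic ∧ (monicOrthogonal B n).natDegree = n := by
  induction n using Nat.strong_induction_on with
  | _ n ih =>
    have hdeg : (∑ k : Fin n,
        C (B (X ^ n) (monicOrthogonal B k) / B (monicOrthogonal B k) (monicOrthogonal B k)) *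
          monicOrthogonal B k).degree < (n : WithBot ℕ) := by
      refine (degree_sum_le _ _).trans_lt ?_
      refine (Finset.sup_lt_iff (WithBot.bot_lt_coe n)).mpr ?_
      intro k _
      rw [← smul_eq_C_mul]
      refine (degree_smul_le _ _).trans_lt ?_
      rw [degree_eq_natDegree (ih k k.2).1.ne_zero, (ih k k.2).2]
      exact WithBot.coe_lt_coe.mpr k.2
    rw [monicOrthogonal_eq]
    refine ⟨(monic_X_pow n).sub_of_left (by rwa [degree_X_pow]), ?_⟩
    apply natDegree_eq_of_degree_eq_some
    rw [degree_sub_eq_left_of_degree_lt (by rwa [degree_X_pow]), degree_X_pow]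

theorem isMonicOrthogonalSeq_monicOrthogonal (B : LinearMap.BilinForm ℝ ℝ[X])
    (hs : ∀ p q, B p q = B q p) (hpos : ∀ p, p ≠ 0 → 0 < B p p) :
    IsMonicOrthogonalSeq B (monicOrthogonal B) := by
  have hne : ∀ n, B (monicOrthogonal B n) (monicOrthogonal B n) ≠ 0 := fun n =>
    (hpos _ (monicOrthogonal_monic_natDegree B n).1.ne_zero).ne'
  have key : ∀ n, ∀ m < n, B (monicOrthogonal B n) (monicOrthogonal B m) = 0 := by
    intro n
    induction n using Nat.strong_induction_on with
    | _ n ih =>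
      intro m hm
      rw [monicOrthogonal_eq B n]
      simp only [map_sub, map_sum, LinearMap.sub_apply, LinearMap.sum_apply, ← smul_eq_C_mul,
        map_smul, LinearMap.smul_apply, smul_eq_mul]
      rw [Finset.sum_eq_single (⟨m, hm⟩ : Fin n)]
      · simp only
        rw [div_mul_cancel₀ _ (hne m), sub_self]
      · intro k _ hk
        have hk' : (k : ℕ) ≠ m := fun h => hk (Fin.ext h)
        rcases lt_or_gt_of_ne hk' with h | h
        · rw [hs (monicOrthogonal B k) (monicOrthogonal B m), ih m hm k h, mul_zero]
        · rw [ih k k.2 m h, mul_zero]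
      · simp
  refine ⟨fun n => (monicOrthogonal_monic_natDegree B n).1,
    fun n => (monicOrthogonal_monic_natDegree B n).2, fun m n hmn => ?_, hne⟩
  rcases lt_or_gt_of_ne hmn with h | h
  · rw [hs, key n m h]
  · exact key m n h

theorem IsMonicOrthogonalSeq.eq_monicOrthogonal {B : LinearMap.BilinForm ℝ ℝ[X]} {P : ℕ → ℝ[X]}
    (hP : IsMonicOrthogonalSeq B P) (hs : ∀ p q, B p q = B q p) :
    P = monicOrthogonal B := by
  -- every polynomial of degree less than `n` is orthogonal to `P n`
  have low : ∀ n : ℕ, ∀ d : ℕ, d ≤ n → ∀ q : ℝ[X], q.degree < (d : WithBot ℕ) → B (P n) q = 0 := by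
    intro n d
    induction d with
    | zero =>
      intro _ q hq
      have : q = 0 := by
        rw [← degree_eq_bot]
        exact Nat.WithBot.lt_zero_iff.mp (by simpa using hq)
      simp [this]
    | succ d ih =>
      intro hd q hq
      have h1 : (q - C (q.coeff d) * P d).degree < (d : WithBot ℕ) := by
        rw [degree_lt_iff_coeff_zero] at hq ⊢
        intro m hm
        rw [coeff_sub, coeff_C_mul]
        rcases Nat.eq_or_lt_of_le hm with h | h
        · subst h
          have : (P d).coeff d = 1 := by
            have := (hP.monic d).coeff_natDegree
            rwa [hP.natDegree_eq] at this
          rw [this]; ring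
        · rw [hq m h, coeff_eq_zero_of_natDegree_lt (p := P d) (by rw [hP.natDegree_eq]; exact h)]; ring
      have h2 := ih (by omega) _ h1
      rw [← smul_eq_C_mul, map_sub, map_smul, hP.orthogonal n d (by omega)] at h2
      simpa using h2
  funext n
  induction n using Nat.strong_induction_on with
  | _ n ih =>
    set D := P n - monicOrthogonal B n with hD
    have hDdeg : D.degree < (n : WithBot ℕ) := by
      have hm := monicOrthogonal_monic_natDegree B n
      rw [degree_lt_iff_coeff_zero]
      intro m hmn
      rw [hD, coeff_sub]
      rcases Nat.eq_or_lt_of_le hmn with h | h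
      · subst h
        have e1 := (hP.monic n).coeff_natDegree
        have e2 := hm.1.coeff_natDegree
        rw [hP.natDegree_eq] at e1
        rw [hm.2] at e2
        rw [e1, e2, sub_self]
      · rw [coeff_eq_zero_of_natDegree_lt (by rw [hP.natDegree_eq]; exact h),
          coeff_eq_zero_of_natDegree_lt (by rw [hm.2]; exact h), sub_self]
    -- `D` is orthogonal to every `P m` with `m < n`
    have hDorth : ∀ m < n, B (P m) D = 0 := by
      intro m hm
      rw [hs, hD, map_sub, LinearMap.sub_apply, hP.orthogonal n m (by omega), zero_sub,
        neg_eq_zero, monicOrthogonal_eq]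
      simp only [map_sub, map_sum, LinearMap.sub_apply, LinearMap.sum_apply, ← smul_eq_C_mul,
        map_smul, LinearMap.smul_apply, smul_eq_mul]
      rw [Finset.sum_eq_single (⟨m, hm⟩ : Fin n)]
      · simp only
        rw [← ih m hm, div_mul_cancel₀ _ (hP.norm_ne_zero m), sub_self]
      · intro k _ hk
        have hk' : (k : ℕ) ≠ m := fun h => hk (Fin.ext h)
        rw [← ih k k.2, hP.orthogonal k m hk', mul_zero]
      · simp
    -- hence `D = 0`, comparing leading coefficients
    have hD0 : D = 0 := by
      by_contra hne
      have hlt : D.natDegree < n := by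
        rw [degree_eq_natDegree hne] at hDdeg
        exact_mod_cast hDdeg
      set m := D.natDegree with hm
      have h1 : (D - C D.leadingCoeff * P m).degree < (m : WithBot ℕ) := by
        rw [degree_lt_iff_coeff_zero]
        intro j hj
        rw [coeff_sub, coeff_C_mul]
        rcases Nat.eq_or_lt_of_le hj with h | h
        · have : (P m).coeff m = 1 := by
            have := (hP.monic m).coeff_natDegree
            rwa [hP.natDegree_eq] at this
          rw [← h, this, hm, coeff_natDegree]; ring
        · rw [coeff_eq_zero_of_natDegree_lt h,
            coeff_eq_zero_of_natDegree_lt (by rw [hP.natDegree_eq]; exact h)]; ring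
      have h2 := low m m le_rfl _ h1
      rw [← smul_eq_C_mul, map_sub, map_smul, hDorth m hlt, zero_sub, neg_eq_zero, smul_eq_mul,
        mul_eq_zero] at h2
      rcases h2 with h2 | h2
      · exact hne (leadingCoeff_eq_zero.mp h2)
      · exact hP.norm_ne_zero m h2
    exact sub_eq_zero.mp hD0

/-! ### The Freud inner product and the Freud-Sobolev inner product -/

theorem integrable_eval_mul_exp_neg_pow_four (p : ℝ[X]) :
    Integrable (fun x : ℝ => p.eval x * Real.exp (-x ^ 4)) := by
  induction p using Polynomial.induction_on' with
  | add p q hp hq =>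
    refine (hp.add hq).congr (Eventually.of_forall fun x => ?_)
    simp [add_mul]
  | monomial n a =>
    have h0 : Integrable (fun x : ℝ => |x| ^ n * Real.exp (-1 * x ^ 2)) := by
      have h := (integrable_rpow_mul_exp_neg_mul_sq (b := 1) one_pos (s := (n : ℝ))
        (by have : (0 : ℝ) ≤ n := n.cast_nonneg
            linarith)).norm
      refine h.congr (Eventually.of_forall fun x => ?_)
      simp [Real.rpow_natCast]
    refine (h0.const_mul (|a| * Real.exp 1)).mono' (by fun_prop) (Eventually.of_forall fun x => ?_)
    simp only [eval_monomial, Real.norm_eq_abs, abs_mul, abs_pow, Real.abs_exp]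
    have : Real.exp (-x ^ 4) ≤ Real.exp 1 * Real.exp (-1 * x ^ 2) := by
      rw [← Real.exp_add]
      apply Real.exp_le_exp.mpr
      nlinarith [sq_nonneg (x ^ 2 - 1 / 2)]
    calc |a| * |x| ^ n * Real.exp (-x ^ 4)
        ≤ |a| * |x| ^ n * (Real.exp 1 * Real.exp (-1 * x ^ 2)) := by gcongr
      _ = _ := by ring

/-- The Freud inner product `⟨p, q⟩ = ∫ p(x) q(x) e^{-x⁴} dx` on real polynomials. -/
def freudInner : LinearMap.BilinForm ℝ ℝ[X] :=
  LinearMap.mk₂ ℝ (fun p q : ℝ[X] => ∫ x : ℝ, p.eval x * q.eval x * Real.exp (-x ^ 4))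
    (fun p₁ p₂ q => by
      have h₁ := integrable_eval_mul_exp_neg_pow_four (p₁ * q)
      have h₂ := integrable_eval_mul_exp_neg_pow_four (p₂ * q)
      simp only [eval_mul] at h₁ h₂
      rw [← integral_add h₁ h₂]
      simp only [eval_add, add_mul])
    (fun c p q => by
      rw [smul_eq_mul, ← integral_const_mul]
      simp only [eval_smul, smul_eq_mul, mul_assoc])
    (fun p q₁ q₂ => by
      have h₁ := integrable_eval_mul_exp_neg_pow_four (p * q₁)
      have h₂ := integrable_eval_mul_exp_neg_pow_four (p * q₂)
      simp only [eval_mul] at h₁ h₂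
      rw [← integral_add h₁ h₂]
      simp only [eval_add, add_mul, mul_add])
    (fun c p q => by
      rw [smul_eq_mul, ← integral_const_mul]
      simp only [eval_smul, smul_eq_mul]
      congr 1
      funext x
      ring)

theorem freudInner_apply (p q : ℝ[X]) :
    freudInner p q = ∫ x : ℝ, p.eval x * q.eval x * Real.exp (-x ^ 4) := rfl

/-- The Freud-Sobolev inner product
`⟨p, q⟩₁ = ∫ p(x) q(x) e^{-x⁴} dx + M₀ p(0) q(0) + M₁ p'(0) q'(0)`. -/
def freudSobolevInner (M₀ M₁ : ℝ) : LinearMap.BilinForm ℝ ℝ[X] :=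
  LinearMap.mk₂ ℝ (fun p q : ℝ[X] => freudInner p q + M₀ * p.eval 0 * q.eval 0 +
      M₁ * (derivative p).eval 0 * (derivative q).eval 0)
    (fun p₁ p₂ q => by simp; ring)
    (fun c p q => by simp; ring)
    (fun p q₁ q₂ => by simp; ring)
    (fun c p q => by simp; ring)

theorem freudSobolevInner_apply (M₀ M₁ : ℝ) (p q : ℝ[X]) :
    freudSobolevInner M₀ M₁ p q = freudInner p q + M₀ * p.eval 0 * q.eval 0 +
      M₁ * (derivative p).eval 0 * (derivative q).eval 0 := rfl

theorem freudInner_comm (p q : ℝ[X]) : freudInner p q = freudInner q p := by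
  simp only [freudInner_apply, mul_comm (p.eval _)]

theorem freudInner_self_pos (p : ℝ[X]) (hp : p ≠ 0) : 0 < freudInner p p := by
  rw [freudInner_apply]
  obtain ⟨x, hx⟩ : ∃ x : ℝ, p.eval x ≠ 0 := by
    by_contra! h
    exact hp (Polynomial.funext fun x => by simpa using h x)
  have hi := integrable_eval_mul_exp_neg_pow_four (p * p)
  simp only [eval_mul] at hi
  exact integral_pos_of_integrable_nonneg_nonzero (x := x) (by fun_prop) hi
    (fun y => mul_nonneg (mul_self_nonneg _) (Real.exp_pos _).le)
    (mul_ne_zero (mul_ne_zero hx hx) (Real.exp_pos _).ne')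

/-- The monic Freud polynomials `F n`. -/
def freudPoly (n : ℕ) : ℝ[X] := monicOrthogonal freudInner n

/-- The monic Freud-Sobolev type polynomials `Q n` for the masses `M₀`, `M₁`. -/
def freudSobolevPoly (M₀ M₁ : ℝ) (n : ℕ) : ℝ[X] := monicOrthogonal (freudSobolevInner M₀ M₁) n

theorem isMonicOrthogonalSeq_freudPoly : IsMonicOrthogonalSeq freudInner freudPoly :=
  isMonicOrthogonalSeq_monicOrthogonal _ freudInner_comm freudInner_self_pos

theorem isMonicOrthogonalSeq_freudSobolevPoly {M₀ M₁ : ℝ} (h₀ : 0 ≤ M₀) (h₁ : 0 ≤ M₁) :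
    IsMonicOrthogonalSeq (freudSobolevInner M₀ M₁) (freudSobolevPoly M₀ M₁) := by
  refine isMonicOrthogonalSeq_monicOrthogonal _ (fun p q => ?_) (fun p hp => ?_)
  · rw [freudSobolevInner_apply, freudSobolevInner_apply, freudInner_comm]; ring
  · rw [freudSobolevInner_apply]
    have := freudInner_self_pos p hp
    have e₀ : 0 ≤ M₀ * p.eval 0 * p.eval 0 := by
      rw [mul_assoc]; exact mul_nonneg h₀ (mul_self_nonneg _)
    have e₁ : 0 ≤ M₁ * (derivative p).eval 0 * (derivative p).eval 0 := by
      rw [mul_assoc]; exact mul_nonneg h₁ (mul_self_nonneg _)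
    linarith

/-! ### Reproducing kernels and the limit polynomials -/

/-- The reproducing kernel `K n (x, y) = ∑_{i ≤ n} F i (x) F i (y) / ‖F i‖²`. -/
def freudKernel (n : ℕ) (x y : ℝ) : ℝ :=
  ∑ i ∈ Finset.range (n + 1),
    (freudPoly i).eval x * (freudPoly i).eval y / freudInner (freudPoly i) (freudPoly i)

/-- The partial derivative `∂^{j+k} K n / ∂x^j ∂y^k (x, y)` of the reproducing kernel, as a
polynomial in `x` for a fixed `y` (see `eval_freudKernelDeriv`). -/
def freudKernelDeriv (n j k : ℕ) (y : ℝ) : ℝ[X] :=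
  ∑ i ∈ Finset.range (n + 1),
    C ((derivative^[k] (freudPoly i)).eval y / freudInner (freudPoly i) (freudPoly i)) *
      derivative^[j] (freudPoly i)

theorem iteratedDeriv_polynomial_eval (p : ℝ[X]) (k : ℕ) (x : ℝ) :
    iteratedDeriv k (fun t => p.eval t) x = (derivative^[k] p).eval x := by
  induction k generalizing p with
  | zero => simp
  | succ k ih =>
    rw [iteratedDeriv_succ', Function.iterate_succ_apply, ← ih]
    congr 1
    funext t
    exact p.deriv

theorem eval_freudKernelDeriv (n j k : ℕ) (x y : ℝ) :
    (freudKernelDeriv n j k y).eval x =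
      iteratedDeriv j (fun s => iteratedDeriv k (fun t => freudKernel n s t) y) x := by
  have h1 : ∀ s : ℝ, iteratedDeriv k (fun t => freudKernel n s t) y =
      (freudKernelDeriv n 0 k y).eval s := by
    intro s
    have : (fun t => freudKernel n s t) = fun t => (∑ i ∈ Finset.range (n + 1),
        C ((freudPoly i).eval s / freudInner (freudPoly i) (freudPoly i)) *
          freudPoly i).eval t := by
      funext t
      simp only [freudKernel, eval_finsetSum, eval_mul, eval_C]
      exact Finset.sum_congr rfl fun i _ => by ring
    rw [this, iteratedDeriv_polynomial_eval]
    simp only [freudKernelDeriv, iterate_derivative_sum, iterate_derivative_C_mul, eval_finsetSum,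
      eval_mul, eval_C, Function.iterate_zero, id]
    exact Finset.sum_congr rfl fun i _ => by ring
  simp only [h1]
  rw [iteratedDeriv_polynomial_eval]
  simp only [freudKernelDeriv, iterate_derivative_sum, iterate_derivative_C_mul,
    Function.iterate_zero, id]

/-- `freudK11 n = K_{2n-1}^{(1,1)}(0, 0)`, for `n ≥ 1`. -/
def freudK11 (n : ℕ) : ℝ := (freudKernelDeriv (2 * n - 1) 1 1 0).eval 0

/-- The limit polynomial `J_{2n+1} = F_{2n+1} - F_{2n+1}'(0) / K_{2n-1}^{(1,1)}(0,0) ·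
K_{2n-1}^{(0,1)}(x, 0)`, for `n ≥ 1`. -/
def freudLimitPoly (n : ℕ) : ℝ[X] :=
  freudPoly (2 * n + 1) -
    C ((derivative (freudPoly (2 * n + 1))).eval 0 / freudK11 n) *
      freudKernelDeriv (2 * n - 1) 0 1 0

/-- `z 1 < z 2 < ⋯ < z n` are exactly the elements of `S`, in increasing order. -/
def IsIncreasingList (n : ℕ) (z : ℕ → ℝ) (S : Set ℝ) : Prop :=
  StrictMonoOn z (Set.Icc 1 n) ∧ z '' Set.Icc 1 n = S

end

/-!
The polynomials involved are odd, so they are studied in the variable `t = x²`: write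
`F_{2n+1}(x) = x f(x²)`, `K_{2n-1}^{(0,1)}(x, 0) = x k(x²)` and `J_{2n+1}(x) = x j(x²)`. Then `f` is
the monic orthogonal polynomial of degree `n` of the functional `L p = ∫ x² p(x²) e^{-x⁴} dx`, which
is positive on the half-line, `k` is its reproducing kernel with pole `0`, and
`j = f - (f(0) / k(0)) k`. The reproducing property of the kernel gives `Q_{2n+1}` explicitly
(`freudSobolevPoly_odd_eq`), and up to a constant factor `Q_{2n+1}(x)` is `x p(x²)`, where
`p = f + m j` and `m = M₁ K_{2n-1}^{(1,1)}(0, 0)`.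

A non-real, non-positive or multiple zero of `f` would give a factor `q` of `f` with `L (q g²) > 0`
for all `g ≠ 0`, contradicting orthogonality; so `f` has `n` simple positive zeros `t i`
(`IsHalfLinePositive.exists_eq_nodal`). Testing `k` against `f / (X - t i)` shows that `j (t i)` has
the sign of `f' (t i)` (`IsHalfLinePositive.sign_eval_sub_kernel`). Since `j(0) = 0`, the zeros of
`j` are `0` and one point in each gap between consecutive `t i`, so the zeros of `j` and `f`
interlace.

For interlacing nodes `s` and `t`, signs at the nodes place one zero of
`∏ (X - t i) + m ∏ (X - s i)` in each interval `(s k, t k]`. The sign of this polynomial at a given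
point of the interval shows that the zero decreases to `s k` as `m` grows, and dividing its equation
by `∏_{i ≠ k} (X - s i)` gives the limit of `m` times its distance to `s k`
(`Interlace.tendsto_mul_pencilRoot_sub`). Taking square roots yields the claims about `Q_{2n+1}`; the
smallest zero behaves differently because the square root is not differentiable at `s 1 = 0`.
-/

noncomputable section


/-! ### Interlacing nodes and the signs of nodal polynomials -/

theorem Lagrange.neg_one_pow_mul_eval_nodal_pos {ι : Type*} {I : Finset ι} {v : ι → ℝ} {u : ℝ}
    (h : ∀ i ∈ I, u ≠ v i) :
    0 < (-1) ^ (I.filter fun i => u < v i).card * (Lagrange.nodal I v).eval u := by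
  have h1 : (-1 : ℝ) ^ (I.filter fun i => u < v i).card =
      ∏ i ∈ I, if u < v i then (-1 : ℝ) else 1 := by
    rw [Finset.prod_ite]; simp
  rw [h1, Lagrange.eval_nodal, ← Finset.prod_mul_distrib]
  refine Finset.prod_pos fun i hi => ?_
  split_ifs with hlt
  · linarith
  · have := lt_of_le_of_ne (not_lt.mp hlt) (h i hi).symm
    linarith

/-- The sign of `∏ (u - v i)` at a point `u` with exactly `v 1, …, v k` to its left. -/
theorem Lagrange.sign_eval_nodal {n k : ℕ} {v : ℕ → ℝ} {u : ℝ}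
    (h1 : ∀ i, 1 ≤ i → i ≤ k → v i < u) (h2 : ∀ i, k < i → i ≤ n → u < v i) :
    0 < (-1) ^ (n - k) * (Lagrange.nodal (Finset.Icc 1 n) v).eval u := by
  have hf : (Finset.Icc 1 n).filter (fun i => u < v i) = Finset.Icc (k + 1) n := by
    ext i
    simp only [Finset.mem_filter, Finset.mem_Icc]
    constructor
    · rintro ⟨⟨hi, hin⟩, hu⟩
      refine ⟨?_, hin⟩
      by_contra! hk
      exact absurd (h1 i hi (by omega)) (not_lt.mpr hu.le)
    · rintro ⟨hi, hin⟩
      exact ⟨⟨by omega, hin⟩, h2 i (by omega) hin⟩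
  have := Lagrange.neg_one_pow_mul_eval_nodal_pos (I := Finset.Icc 1 n) (v := v) (u := u) (by
    intro i hi
    rw [Finset.mem_Icc] at hi
    rcases le_or_gt i k with h | h
    · exact (h1 i hi.1 h).ne'
    · exact (h2 i h hi.2).ne)
  rwa [hf, Nat.card_Icc, show n + 1 - (k + 1) = n - k by omega] at this

/-- The sign of `∏_{i ≠ k} (v k - v i)` for increasing nodes `v 1 < ⋯ < v n`. -/
theorem Lagrange.sign_eval_nodal_erase {n k : ℕ} {v : ℕ → ℝ}
    (hv : StrictMonoOn v (Set.Icc 1 n)) (hk : 1 ≤ k) (hkn : k ≤ n) :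
    0 < (-1) ^ (n - k) * (Lagrange.nodal ((Finset.Icc 1 n).erase k) v).eval (v k) := by
  have hf : ((Finset.Icc 1 n).erase k).filter (fun i => v k < v i) = Finset.Icc (k + 1) n := by
    ext i
    simp only [Finset.mem_filter, Finset.mem_Icc, Finset.mem_erase]
    constructor
    · rintro ⟨⟨-, hi⟩, hu⟩
      have := (hv.lt_iff_lt ⟨hk, hkn⟩ hi).mp hu
      omega
    · rintro ⟨hi, hin⟩
      exact ⟨⟨by omega, by omega, hin⟩, hv ⟨hk, hkn⟩ ⟨by omega, hin⟩ (by omega)⟩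
  have := Lagrange.neg_one_pow_mul_eval_nodal_pos (I := (Finset.Icc 1 n).erase k) (v := v)
    (u := v k) (by
    intro i hi
    rw [Finset.mem_erase, Finset.mem_Icc] at hi
    exact fun h => hi.1 (hv.injOn ⟨hk, hkn⟩ hi.2 h).symm)
  rwa [hf, Nat.card_Icc, show n + 1 - (k + 1) = n - k by omega] at this

/-- A monic polynomial of degree `n` vanishing at `n` increasing points is their nodal
polynomial. -/
theorem Polynomial.Monic.eq_nodal {p : ℝ[X]} {n : ℕ} {v : ℕ → ℝ} (hp : p.Monic)
    (hdeg : p.natDegree = n) (hv : StrictMonoOn v (Set.Icc 1 n))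
    (hroot : ∀ k, 1 ≤ k → k ≤ n → p.eval (v k) = 0) :
    p = Lagrange.nodal (Finset.Icc 1 n) v := by
  refine eq_of_monic_of_dvd_of_natDegree_le Lagrange.nodal_monic hp ?_ ?_
  · rw [Lagrange.nodal_eq]
    refine Finset.prod_dvd_of_coprime ?_ ?_
    · intro i hi j hj hij
      rw [Finset.coe_Icc] at hi hj
      exact isCoprime_X_sub_C_of_isUnit_sub
        (sub_ne_zero.mpr fun h => hij (hv.injOn hi hj h)).isUnit
    · intro i hi
      rw [Finset.mem_Icc] at hi
      exact dvd_iff_isRoot.mpr (hroot i hi.1 hi.2)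
  · rw [Lagrange.natDegree_nodal, hdeg]; simp

theorem Lagrange.eval_nodal_eq_zero_iff {n : ℕ} {v : ℕ → ℝ} {u : ℝ} :
    (Lagrange.nodal (Finset.Icc 1 n) v).eval u = 0 ↔ ∃ k, 1 ≤ k ∧ k ≤ n ∧ v k = u := by
  rw [Lagrange.eval_nodal, Finset.prod_eq_zero_iff]
  simp only [Finset.mem_Icc, sub_eq_zero, and_assoc, eq_comm]

/-- A polynomial changing sign between `a` and `b` has a zero there; the factor `e` is a sign. -/
theorem Polynomial.exists_root_Ioo {p : ℝ[X]} {a b e : ℝ} (hab : a < b) (ha : e * p.eval a < 0)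
    (hb : 0 < e * p.eval b) : ∃ z, a < z ∧ z < b ∧ p.eval z = 0 := by
  obtain ⟨z, hz, h0⟩ := intermediate_value_Ioo hab.le
    (f := fun z => e * p.eval z) (by fun_prop) ⟨ha, hb⟩
  refine ⟨z, hz.1, hz.2, (mul_eq_zero.mp h0).resolve_left ?_⟩
  rintro rfl
  simp at ha

/-- The interlacing pattern `s 1 < t 1 < s 2 < t 2 < ⋯ < s n < t n`. -/
structure Interlace (n : ℕ) (s t : ℕ → ℝ) : Prop where
  lt : ∀ k, 1 ≤ k → k ≤ n → s k < t k
  lt_succ : ∀ k, 1 ≤ k → k < n → t k < s (k + 1)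

namespace Interlace

variable {n : ℕ} {s t : ℕ → ℝ}

theorem right_lt_left (h : Interlace n s t) {i k : ℕ} (hi : 1 ≤ i) (hik : i < k) (hk : k ≤ n) :
    t i < s k := by
  induction k, hik using Nat.le_induction with
  | base => exact h.lt_succ i hi (by omega)
  | succ k hik ih =>
    exact ((ih (by omega)).trans (h.lt k (by omega) (by omega))).trans
      (h.lt_succ k (by omega) (by omega))

/-- Any choice of one point in each interval `[s k, t k]` is increasing. -/
theorem strictMonoOn (h : Interlace n s t) {z : ℕ → ℝ}
    (hz : ∀ k, 1 ≤ k → k ≤ n → s k ≤ z k ∧ z k ≤ t k) : StrictMonoOn z (Set.Icc 1 n) := by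
  intro i hi k hk hik
  exact ((hz i hi.1 hi.2).2.trans_lt (h.right_lt_left hi.1 hik hk.2)).trans_le (hz k hk.1 hk.2).1

theorem strictMonoOn_left (h : Interlace n s t) : StrictMonoOn s (Set.Icc 1 n) :=
  h.strictMonoOn fun k hk hkn => ⟨le_rfl, (h.lt k hk hkn).le⟩

theorem strictMonoOn_right (h : Interlace n s t) : StrictMonoOn t (Set.Icc 1 n) :=
  h.strictMonoOn fun k hk hkn => ⟨(h.lt k hk hkn).le, le_rfl⟩

theorem sign_right (h : Interlace n s t) {k : ℕ} (hk : 1 ≤ k) (hkn : k ≤ n) :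
    (-1) ^ (n - k) * (Lagrange.nodal (Finset.Icc 1 n) t).eval (s k) < 0 := by
  have := Lagrange.sign_eval_nodal (n := n) (k := k - 1) (v := t) (u := s k)
    (fun i hi hik => h.right_lt_left hi (by omega) hkn)
    (fun i hi hin => ((h.strictMonoOn_left.monotoneOn ⟨hk, hkn⟩ ⟨by omega, hin⟩
      (by omega)).trans_lt (h.lt i (by omega) hin)))
  rw [show n - (k - 1) = n - k + 1 by omega, pow_succ] at this
  linarith

theorem sign_left (h : Interlace n s t) {k : ℕ} (hk : 1 ≤ k) (hkn : k ≤ n) {u : ℝ}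
    (h1 : s k < u) (h2 : u ≤ t k) :
    0 < (-1) ^ (n - k) * (Lagrange.nodal (Finset.Icc 1 n) s).eval u :=
  Lagrange.sign_eval_nodal
    (fun i hi hik => (h.strictMonoOn_left.monotoneOn ⟨hi, by omega⟩ ⟨hk, hkn⟩ hik).trans_lt h1)
    (fun i hi hin => h2.trans_lt (h.right_lt_left hk hi hin))

/-! ### The zeros of a pencil spanned by two interlacing polynomials -/

/-- The pencil `∏ (X - t i) + m ∏ (X - s i)`. -/
def pencil (n : ℕ) (s t : ℕ → ℝ) (m : ℝ) : ℝ[X] :=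
  Lagrange.nodal (Finset.Icc 1 n) t + C m * Lagrange.nodal (Finset.Icc 1 n) s

theorem eval_pencil (m u : ℝ) : (pencil n s t m).eval u =
    (Lagrange.nodal (Finset.Icc 1 n) t).eval u +
      m * (Lagrange.nodal (Finset.Icc 1 n) s).eval u := by
  simp [pencil]

theorem sign_pencil_left (h : Interlace n s t) {k : ℕ} (hk : 1 ≤ k) (hkn : k ≤ n) (m : ℝ) :
    (-1) ^ (n - k) * (pencil n s t m).eval (s k) < 0 := by
  rw [eval_pencil, Lagrange.eval_nodal_at_node (Finset.mem_Icc.mpr ⟨hk, hkn⟩), mul_zero, add_zero]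
  exact h.sign_right hk hkn

theorem exists_root_pencil (h : Interlace n s t) {m : ℝ} (hm : 0 ≤ m) {k : ℕ} (hk : 1 ≤ k)
    (hkn : k ≤ n) : ∃ z, s k < z ∧ z ≤ t k ∧ (0 < m → z < t k) ∧ (pencil n s t m).eval z = 0 := by
  have ht : (Lagrange.nodal (Finset.Icc 1 n) t).eval (t k) = 0 :=
    Lagrange.eval_nodal_at_node (Finset.mem_Icc.mpr ⟨hk, hkn⟩)
  rcases hm.eq_or_lt with rfl | hm
  · exact ⟨t k, h.lt k hk hkn, le_rfl, fun h => absurd h (lt_irrefl _), by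
      rw [eval_pencil, ht, zero_mul, add_zero]⟩
  · obtain ⟨z, h1, h2, h3⟩ := exists_root_Ioo (h.lt k hk hkn) (h.sign_pencil_left hk hkn m) (by
      rw [eval_pencil, ht, zero_add, mul_left_comm]
      exact mul_pos hm (h.sign_left hk hkn (h.lt k hk hkn) le_rfl))
    exact ⟨z, h1, h2.le, fun _ => h2, h3⟩

open Classical in
/-- The zero of the pencil in the interval `(s k, t k]`; it exists for `m ≥ 0` and `1 ≤ k ≤ n` if
`s` and `t` interlace. -/
def pencilRoot (n : ℕ) (s t : ℕ → ℝ) (m : ℝ) (k : ℕ) : ℝ :=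
  if h : ∃ z, s k < z ∧ z ≤ t k ∧ (0 < m → z < t k) ∧ (pencil n s t m).eval z = 0 then h.choose
  else 0

theorem pencilRoot_spec (h : Interlace n s t) {m : ℝ} (hm : 0 ≤ m) {k : ℕ} (hk : 1 ≤ k)
    (hkn : k ≤ n) : s k < pencilRoot n s t m k ∧ pencilRoot n s t m k ≤ t k ∧
      (0 < m → pencilRoot n s t m k < t k) ∧
      (pencil n s t m).eval (pencilRoot n s t m k) = 0 := by
  have hex := h.exists_root_pencil hm hk hkn
  rw [pencilRoot, dif_pos hex]
  exact hex.choose_spec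

theorem strictMonoOn_pencilRoot (h : Interlace n s t) {m : ℝ} (hm : 0 ≤ m) :
    StrictMonoOn (pencilRoot n s t m) (Set.Icc 1 n) :=
  h.strictMonoOn fun _ hk hkn =>
    ⟨(h.pencilRoot_spec hm hk hkn).1.le, (h.pencilRoot_spec hm hk hkn).2.1⟩

theorem pencil_eq (h : Interlace n s t) {m : ℝ} (hm : 0 ≤ m) :
    pencil n s t m = C (1 + m) * Lagrange.nodal (Finset.Icc 1 n) (pencilRoot n s t m) := by
  have hm1 : (1 + m) ≠ 0 := by linarith
  have hcoeff : (pencil n s t m).coeff n = 1 + m := by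
    have ht := (Lagrange.nodal_monic (s := Finset.Icc 1 n) (v := t)).coeff_natDegree
    have hs := (Lagrange.nodal_monic (s := Finset.Icc 1 n) (v := s)).coeff_natDegree
    simp only [Lagrange.natDegree_nodal, Nat.card_Icc, Nat.add_sub_cancel] at ht hs
    simp [pencil, ht, hs]
  have hle : (pencil n s t m).natDegree ≤ n := by
    refine (natDegree_add_le _ _).trans (max_le ?_ ((natDegree_C_mul_le _ _).trans ?_)) <;>
    simp [Lagrange.natDegree_nodal]
  have hdeg : (pencil n s t m).natDegree = n :=
    le_antisymm hle (le_natDegree_of_ne_zero (by rwa [hcoeff]))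
  have hmonic : (C (1 + m)⁻¹ * pencil n s t m).Monic := by
    apply monic_C_mul_of_mul_leadingCoeff_eq_one
    rw [leadingCoeff, hdeg, hcoeff, inv_mul_cancel₀ hm1]
  rw [← hmonic.eq_nodal (n := n) (v := pencilRoot n s t m)
    (by rw [natDegree_C_mul (inv_ne_zero hm1), hdeg]) (h.strictMonoOn_pencilRoot hm)
    (fun k hk hkn => by rw [eval_mul, (h.pencilRoot_spec hm hk hkn).2.2.2, mul_zero]),
    ← mul_assoc, ← C_mul, mul_inv_cancel₀ hm1, C_1, one_mul]

theorem eval_pencil_eq_zero_iff (h : Interlace n s t) {m : ℝ} (hm : 0 ≤ m) {u : ℝ} :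
    (pencil n s t m).eval u = 0 ↔ ∃ k, 1 ≤ k ∧ k ≤ n ∧ pencilRoot n s t m k = u := by
  rw [h.pencil_eq hm, eval_mul, eval_C, mul_eq_zero, Lagrange.eval_nodal_eq_zero_iff,
    or_iff_right (by linarith : 1 + m ≠ 0)]

theorem eq_pencilRoot (h : Interlace n s t) {m : ℝ} (hm : 0 ≤ m) {k : ℕ} (hk : 1 ≤ k)
    (hkn : k ≤ n) {z : ℝ} (h1 : s k < z) (h2 : z ≤ t k) (h0 : (pencil n s t m).eval z = 0) :
    pencilRoot n s t m k = z := by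
  obtain ⟨i, hi, hin, rfl⟩ := (h.eval_pencil_eq_zero_iff hm).mp h0
  obtain ⟨hs, ht, -⟩ := h.pencilRoot_spec hm hi hin
  rcases lt_trichotomy i k with hik | rfl | hik
  · exact absurd (h.right_lt_left hi hik hkn) (by linarith)
  · rfl
  · exact absurd (h.right_lt_left hk hik hin) (by linarith)

/-- If the pencil has the sign of its right end at `u ∈ (s k, t k]`, then its zero lies to the left
of `u`. -/
theorem pencilRoot_lt (h : Interlace n s t) {m : ℝ} (hm : 0 ≤ m) {k : ℕ} (hk : 1 ≤ k)
    (hkn : k ≤ n) {u : ℝ} (h1 : s k < u) (h2 : u ≤ t k)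
    (h0 : 0 < (-1) ^ (n - k) * (pencil n s t m).eval u) : pencilRoot n s t m k < u := by
  obtain ⟨z, hz1, hz2, hz⟩ := exists_root_Ioo h1 (h.sign_pencil_left hk hkn m) h0
  rwa [h.eq_pencilRoot hm hk hkn hz1 (hz2.le.trans h2) hz]

theorem strictAntiOn_pencilRoot (h : Interlace n s t) {k : ℕ} (hk : 1 ≤ k) (hkn : k ≤ n) :
    StrictAntiOn (fun m => pencilRoot n s t m k) (Set.Ici 0) := by
  intro m hm m' hm' hlt
  obtain ⟨h1, h2, -, h0⟩ := h.pencilRoot_spec hm hk hkn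
  refine h.pencilRoot_lt hm' hk hkn h1 h2 ?_
  -- at a zero of the pencil for `m` only the increment of the parameter contributes
  have := mul_pos (sub_pos.mpr hlt) (h.sign_left hk hkn h1 h2)
  rw [eval_pencil] at h0 ⊢
  rw [eq_neg_of_add_eq_zero_left h0]
  linarith

theorem tendsto_pencilRoot (h : Interlace n s t) {k : ℕ} (hk : 1 ≤ k) (hkn : k ≤ n) :
    Tendsto (fun m => pencilRoot n s t m k) atTop (𝓝 (s k)) := by
  rw [tendsto_order]
  constructor
  · intro a ha
    filter_upwards [eventually_ge_atTop 0] with m hm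
    exact ha.trans (h.pencilRoot_spec hm hk hkn).1
  · intro a ha
    have h1 : s k < min a (t k) := lt_min ha (h.lt k hk hkn)
    have h2 : min a (t k) ≤ t k := min_le_right _ _
    have hpos := h.sign_left hk hkn h1 h2
    have hlim : Tendsto (fun m => (-1) ^ (n - k) * (Lagrange.nodal (Finset.Icc 1 n) t).eval
        (min a (t k)) + m * ((-1) ^ (n - k) * (Lagrange.nodal (Finset.Icc 1 n) s).eval
        (min a (t k)))) atTop atTop :=
      tendsto_atTop_add_const_left _ _ (tendsto_id.atTop_mul_const hpos)
    filter_upwards [eventually_ge_atTop 0, hlim.eventually_gt_atTop 0] with m hm hm2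
    refine (h.pencilRoot_lt hm hk hkn h1 h2 ?_).trans_le (min_le_left _ _)
    rw [eval_pencil]
    linarith

/-- First-order asymptotics of the zeros of the pencil: dividing the equation of the `k`-th zero
`r` by the factor `∏_{i ≠ k} (r - s i)` gives `m (r - s k)` as a continuous function of `r`. -/
theorem tendsto_mul_pencilRoot_sub (h : Interlace n s t) {k : ℕ} (hk : 1 ≤ k) (hkn : k ≤ n) :
    Tendsto (fun m => m * (pencilRoot n s t m k - s k)) atTop
      (𝓝 (-(Lagrange.nodal (Finset.Icc 1 n) t).eval (s k) /
        (derivative (Lagrange.nodal (Finset.Icc 1 n) s)).eval (s k))) := by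
  have hmem : k ∈ Finset.Icc 1 n := Finset.mem_Icc.mpr ⟨hk, hkn⟩
  rw [Lagrange.eval_nodal_derivative_eval_node_eq hmem]
  have hne : (Lagrange.nodal ((Finset.Icc 1 n).erase k) s).eval (s k) ≠ 0 := by
    intro h0
    have := Lagrange.sign_eval_nodal_erase h.strictMonoOn_left hk hkn
    rw [h0, mul_zero] at this
    exact lt_irrefl _ this
  have hcont : ContinuousAt (fun u => -(Lagrange.nodal (Finset.Icc 1 n) t).eval u /
      (Lagrange.nodal ((Finset.Icc 1 n).erase k) s).eval u) (s k) :=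
    ContinuousAt.div (by fun_prop) (by fun_prop) hne
  refine (hcont.tendsto.comp (h.tendsto_pencilRoot hk hkn)).congr' ?_
  have hev := ((Lagrange.nodal ((Finset.Icc 1 n).erase k) s).continuous.continuousAt.tendsto.comp
    (h.tendsto_pencilRoot hk hkn)).eventually_ne hne
  filter_upwards [eventually_ge_atTop 0, hev] with m hm hm2
  have h0 := (h.pencilRoot_spec hm hk hkn).2.2.2
  rw [eval_pencil, Lagrange.nodal_eq_mul_nodal_erase (v := s) hmem, eval_mul, eval_sub, eval_X,
    eval_C] at h0
  simp only [Function.comp_apply] at hm2 ⊢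
  rw [div_eq_iff hm2]
  linarith

end Interlace


/-! ### Orthogonality with respect to a positive functional on the half-line -/

/-- A moment functional `L` that is positive definite on the half-line `[0, ∞)`: both
`(p, q) ↦ L (p q)` and `(p, q) ↦ L (X p q)` are positive definite. -/
structure IsHalfLinePositive (L : ℝ[X] →ₗ[ℝ] ℝ) : Prop where
  mul_self_pos : ∀ p, p ≠ 0 → 0 < L (p * p)
  X_mul_self_pos : ∀ p, p ≠ 0 → 0 < L (X * (p * p))

namespace IsHalfLinePositive

variable {L : ℝ[X] →ₗ[ℝ] ℝ} {n : ℕ} {f : ℝ[X]}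

theorem map_C_mul (L : ℝ[X] →ₗ[ℝ] ℝ) (a : ℝ) (p : ℝ[X]) : L (C a * p) = a * L p := by
  rw [← smul_eq_C_mul, map_smul, smul_eq_mul]

/-- If `f = q g` is orthogonal to all polynomials of smaller degree and `q` is not constant, then
`f` is orthogonal to `g`. The polynomials `q` with `L (q g²) > 0` for all `g` therefore do not
divide `f`. -/
theorem map_factor_mul_self (hf : f.Monic) (hdeg : f.natDegree = n)
    (horth : ∀ q : ℝ[X], q.degree < n → L (f * q) = 0) {q g : ℝ[X]} (hfac : f = q * g)
    (hq : 0 < q.natDegree) : g ≠ 0 ∧ L (q * (g * g)) = 0 := by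
  have hg : g ≠ 0 := by
    rintro rfl
    exact hf.ne_zero (by simp [hfac])
  have hq0 : q ≠ 0 := by
    rintro rfl
    simp at hq
  refine ⟨hg, ?_⟩
  rw [← mul_assoc, ← hfac]
  apply horth
  rw [degree_eq_natDegree hg]
  have := natDegree_mul hq0 hg
  rw [← hfac, hdeg] at this
  exact_mod_cast (by omega : g.natDegree < n)

theorem root_pos (hL : IsHalfLinePositive L) (hf : f.Monic) (hdeg : f.natDegree = n)
    (horth : ∀ q : ℝ[X], q.degree < n → L (f * q) = 0) {a : ℝ} (ha : f.IsRoot a) : 0 < a := by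
  by_contra! hle
  obtain ⟨g, hg⟩ := dvd_iff_isRoot.mpr ha
  obtain ⟨hg0, h0⟩ := map_factor_mul_self hf hdeg horth hg (by simp)
  rw [sub_mul, map_sub, map_C_mul] at h0
  nlinarith [hL.mul_self_pos g hg0, hL.X_mul_self_pos g hg0]

theorem not_sq_dvd (hL : IsHalfLinePositive L) (hf : f.Monic) (hdeg : f.natDegree = n)
    (horth : ∀ q : ℝ[X], q.degree < n → L (f * q) = 0) (a : ℝ) : ¬ (X - C a) ^ 2 ∣ f := by
  rintro ⟨g, hg⟩
  obtain ⟨hg0, h0⟩ := map_factor_mul_self hf hdeg horth hg (by simp [natDegree_pow])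
  have := hL.mul_self_pos _ (mul_ne_zero (X_sub_C_ne_zero a) hg0)
  rw [show (X - C a) * g * ((X - C a) * g) = (X - C a) ^ 2 * (g * g) by ring] at this
  linarith

theorem splits (hL : IsHalfLinePositive L) (hf : f.Monic) (hdeg : f.natDegree = n)
    (horth : ∀ q : ℝ[X], q.degree < n → L (f * q) = 0) : f.Splits := by
  refine Splits.of_splits_map (algebraMap ℝ ℂ) (IsAlgClosed.splits _) fun z hz => ?_
  have hz0 : aeval z f = 0 := by
    rw [← eval_map_algebraMap]
    exact (mem_roots'.mp hz).2
  by_cases him : z.im = 0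
  · exact ⟨z.re, by apply Complex.ext <;> simp [him]⟩
  · -- a non-real zero gives the quadratic factor `(X - re z)² + (im z)²`
    exfalso
    obtain ⟨g, hg⟩ := quadratic_dvd_of_aeval_eq_zero_im_ne_zero f hz0 him
    have hquad : (X ^ 2 - C (2 * z.re) * X + C (‖z‖ ^ 2) : ℝ[X]) =
        (X - C z.re) ^ 2 + C (z.im ^ 2) := by
      rw [Complex.sq_norm, Complex.normSq_apply]
      simp only [map_add, map_mul, map_pow, map_ofNat]
      ring
    rw [hquad] at hg
    obtain ⟨hg0, h0⟩ := map_factor_mul_self hf hdeg horth hg (by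
      rw [natDegree_add_C, natDegree_pow, natDegree_X_sub_C]; norm_num)
    have h1 := hL.mul_self_pos _ (mul_ne_zero (X_sub_C_ne_zero z.re) hg0)
    rw [show (X - C z.re) * g * ((X - C z.re) * g) = (X - C z.re) ^ 2 * (g * g) by ring] at h1
    rw [add_mul, map_add, map_C_mul] at h0
    have h2 := mul_nonneg (sq_nonneg z.im) (hL.mul_self_pos g hg0).le
    linarith

/-- The `n`-th monic orthogonal polynomial of `L` has `n` simple zeros, all of them positive. -/
theorem exists_eq_nodal (hL : IsHalfLinePositive L) (hf : f.Monic) (hdeg : f.natDegree = n)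
    (horth : ∀ q : ℝ[X], q.degree < n → L (f * q) = 0) :
    ∃ t : ℕ → ℝ, StrictMonoOn t (Set.Icc 1 n) ∧ (∀ k, 1 ≤ k → k ≤ n → 0 < t k) ∧
      f = Lagrange.nodal (Finset.Icc 1 n) t := by
  have hnodup : f.roots.Nodup := by
    rw [Multiset.nodup_iff_count_le_one]
    intro a
    by_contra! h
    rw [count_roots] at h
    exact hL.not_sq_dvd hf hdeg horth a ((le_rootMultiplicity_iff hf.ne_zero).mp h)
  have hcard : f.roots.toFinset.card = n := by
    rw [Multiset.toFinset_card_of_nodup hnodup,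
      ← (hL.splits hf hdeg horth).natDegree_eq_card_roots, hdeg]
  let t : ℕ → ℝ := fun k =>
    if h : 1 ≤ k ∧ k ≤ n then f.roots.toFinset.orderEmbOfFin hcard ⟨k - 1, by omega⟩ else 0
  have ht : ∀ k (h : 1 ≤ k ∧ k ≤ n),
      t k = f.roots.toFinset.orderEmbOfFin hcard ⟨k - 1, by omega⟩ := fun k h => dif_pos h
  have hroot : ∀ k, 1 ≤ k → k ≤ n → f.IsRoot (t k) := by
    intro k hk hkn
    rw [ht k ⟨hk, hkn⟩]
    have := Finset.orderEmbOfFin_mem f.roots.toFinset hcard ⟨k - 1, by omega⟩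
    rw [Multiset.mem_toFinset] at this
    exact (mem_roots'.mp this).2
  have hmono : StrictMonoOn t (Set.Icc 1 n) := by
    intro i hi k hk hik
    rw [ht i hi, ht k hk]
    apply (f.roots.toFinset.orderEmbOfFin hcard).strictMono
    have := hi.1
    exact Fin.mk_lt_mk.mpr (by omega)
  exact ⟨t, hmono, fun k hk hkn => hL.root_pos hf hdeg horth (hroot k hk hkn),
    hf.eq_nodal hdeg hmono hroot⟩

/-! ### Modification of the orthogonal polynomial by the reproducing kernel -/

/-- The value at `0` of the reproducing kernel with pole `0` is positive. -/
theorem kernel_eval_zero_pos (hL : IsHalfLinePositive L) (hn : 1 ≤ n) {k : ℝ[X]}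
    (hk : k.degree < n) (hrep : ∀ q : ℝ[X], q.degree < n → L (k * q) = q.eval 0) :
    0 < k.eval 0 := by
  rw [← hrep k hk]
  apply hL.mul_self_pos
  rintro rfl
  have := hrep 1 (by rw [degree_one]; exact_mod_cast hn)
  simp at this

/-- The signs of `j = f - (f(0) / k(0)) k` at the zeros `t i` of the orthogonal polynomial `f`.
With `ℓ = ∏_{l ≠ i} (X - t l)`, every `p` of degree less than `n` satisfies
`L (ℓ p) = p (t i) L ℓ`, since `p - p (t i)` is divisible by `X - t i` and `(X - t i) ℓ = f`.
Taking `p = k` and `p = ℓ` gives the sign of `k (t i)` in terms of that of `ℓ (t i)`. -/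
theorem sign_eval_sub_kernel (hL : IsHalfLinePositive L) (hn : 1 ≤ n) {t : ℕ → ℝ}
    (ht : StrictMonoOn t (Set.Icc 1 n)) (htpos : ∀ i, 1 ≤ i → i ≤ n → 0 < t i)
    (hf : f = Lagrange.nodal (Finset.Icc 1 n) t)
    (horth : ∀ q : ℝ[X], q.degree < n → L (f * q) = 0) {k : ℝ[X]} (hk : k.degree < n)
    (hrep : ∀ q : ℝ[X], q.degree < n → L (k * q) = q.eval 0) {i : ℕ} (hi : 1 ≤ i) (hin : i ≤ n) :
    0 < (-1) ^ (n - i) * (f - C (f.eval 0 / k.eval 0) * k).eval (t i) := by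
  have hmem : i ∈ Finset.Icc 1 n := Finset.mem_Icc.mpr ⟨hi, hin⟩
  set l := Lagrange.nodal ((Finset.Icc 1 n).erase i) t with hl
  have hfl : f = (X - C (t i)) * l := by rw [hf, Lagrange.nodal_eq_mul_nodal_erase hmem]
  have hldeg : l.degree < n := by
    rw [hl, Lagrange.degree_nodal, Finset.card_erase_of_mem hmem, Nat.card_Icc]
    exact_mod_cast (by omega : n + 1 - 1 - 1 < n)
  have hk0 := hL.kernel_eval_zero_pos hn hk hrep
  have hquad : ∀ p : ℝ[X], p.degree < n → L (l * p) = p.eval (t i) * L l := by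
    intro p hp
    have h1 : l * p = f * (p /ₘ (X - C (t i))) + C (p.eval (t i)) * l := by
      conv_lhs => rw [← modByMonic_add_div p (X - C (t i)), modByMonic_X_sub_C_eq_C_eval]
      rw [hfl]
      ring
    rw [h1, map_add, horth _ ((degree_divByMonic_le _ _).trans_lt hp), map_C_mul, zero_add]
  have hl0 : l.eval 0 ≠ 0 := by
    rw [hl, Lagrange.eval_nodal, Finset.prod_ne_zero_iff]
    intro m hm
    have := Finset.mem_Icc.mp (Finset.mem_of_mem_erase hm)
    have := htpos m this.1 this.2
    linarith
  have hkl : k.eval (t i) * L l = l.eval 0 := by rw [← hquad k hk, mul_comm, hrep l hldeg]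
  have hll : 0 < l.eval (t i) * L l := by
    rw [← hquad l hldeg]
    exact hL.mul_self_pos l Lagrange.nodal_ne_zero
  have hsign := Lagrange.sign_eval_nodal_erase ht hi hin
  rw [← hl] at hsign
  have hpos : 0 < (-1) ^ (n - i) * L l := by
    refine pos_of_mul_pos_right ?_ hsign.le
    rw [mul_mul_mul_comm, ← mul_pow]
    simpa using hll
  have hj : 0 < (f - C (f.eval 0 / k.eval 0) * k).eval (t i) * L l := by
    have hft : f.eval (t i) = 0 := by simp [hfl]
    have hf0 : f.eval 0 = -(t i * l.eval 0) := by simp [hfl]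
    have : (f - C (f.eval 0 / k.eval 0) * k).eval (t i) * L l =
        t i * l.eval 0 ^ 2 / k.eval 0 := by
      rw [eval_sub, eval_mul, eval_C, hft, hf0]
      linear_combination (t i * l.eval 0 / k.eval 0) * hkl
    rw [this]
    have := htpos i hi hin
    positivity
  refine pos_of_mul_pos_left ?_ hpos.le
  rw [mul_mul_mul_comm, ← mul_pow]
  simpa using hj

/-- The zeros of the orthogonal polynomial `f` and of `f - (f(0) / k(0)) k`, where `k` is the
reproducing kernel with pole `0`, interlace; the smallest zero of the latter is `0`. -/
theorem exists_interlace (hL : IsHalfLinePositive L) (hn : 1 ≤ n) (hf : f.Monic)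
    (hdeg : f.natDegree = n) (horth : ∀ q : ℝ[X], q.degree < n → L (f * q) = 0) {k : ℝ[X]}
    (hk : k.degree < n) (hrep : ∀ q : ℝ[X], q.degree < n → L (k * q) = q.eval 0) :
    ∃ s t : ℕ → ℝ, Interlace n s t ∧ s 1 = 0 ∧ f = Lagrange.nodal (Finset.Icc 1 n) t ∧
      f - C (f.eval 0 / k.eval 0) * k = Lagrange.nodal (Finset.Icc 1 n) s := by
  obtain ⟨t, ht, htpos, hft⟩ := hL.exists_eq_nodal hf hdeg horth
  have hk0 := hL.kernel_eval_zero_pos hn hk hrep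
  set j := f - C (f.eval 0 / k.eval 0) * k with hj
  have hsign : ∀ i, 1 ≤ i → i ≤ n → 0 < (-1) ^ (n - i) * j.eval (t i) := fun i hi hin =>
    hL.sign_eval_sub_kernel hn ht htpos hft horth hk hrep hi hin
  have hdeg' : (C (f.eval 0 / k.eval 0) * k).degree < f.degree := by
    rw [degree_eq_natDegree hf.ne_zero, hdeg, ← smul_eq_C_mul]
    exact (degree_smul_le _ _).trans_lt hk
  have hjmonic : j.Monic := hf.sub_of_left hdeg'
  have hjdeg : j.natDegree = n := by
    rw [← hdeg]
    exact natDegree_eq_of_degree_eq (degree_sub_eq_left_of_degree_lt hdeg')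
  have hj0 : j.eval 0 = 0 := by
    rw [hj, eval_sub, eval_mul, eval_C, div_mul_cancel₀ _ hk0.ne', sub_self]
  have hex : ∀ i, ∃ z, (i = 1 → z = 0) ∧ (2 ≤ i → i ≤ n → t (i - 1) < z ∧ z < t i) ∧
      (1 ≤ i → i ≤ n → j.eval z = 0) := by
    intro i
    by_cases h : 2 ≤ i ∧ i ≤ n
    · obtain ⟨z, h1, h2, h3⟩ := exists_root_Ioo (p := j) (a := t (i - 1)) (b := t i)
        (e := (-1) ^ (n - i)) (ht ⟨by omega, by omega⟩ ⟨by omega, h.2⟩ (by omega)) (by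
          have := hsign (i - 1) (by omega) (by omega)
          rw [show n - (i - 1) = n - i + 1 by omega, pow_succ] at this
          linarith) (hsign i (by omega) h.2)
      exact ⟨z, by omega, fun _ _ => ⟨h1, h2⟩, fun _ _ => h3⟩
    · exact ⟨0, fun _ => rfl, by omega, fun _ _ => hj0⟩
  choose s hs1 hs2 hs3 using hex
  have hint : Interlace n s t := by
    refine ⟨fun i hi hin => ?_, fun i hi hin => (hs2 (i + 1) (by omega) (by omega)).1⟩
    rcases hi.eq_or_lt with rfl | hi
    · rw [hs1 1 rfl]
      exact htpos 1 le_rfl hin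
    · exact (hs2 i hi hin).2
  exact ⟨s, t, hint, hs1 1 rfl, hft, hjmonic.eq_nodal hjdeg hint.strictMonoOn_left hs3⟩

end IsHalfLinePositive


/-! ### Uniqueness and parity of the Freud polynomials -/

namespace IsMonicOrthogonalSeq

variable {B : LinearMap.BilinForm ℝ ℝ[X]} {P : ℕ → ℝ[X]}

/-- The polynomials `P i`, `i < N`, span the polynomials of degree less than `N`. -/
theorem linearMap_eq_zero (hP : IsMonicOrthogonalSeq B P) {φ : ℝ[X] →ₗ[ℝ] ℝ} {N : ℕ}
    (h : ∀ i < N, φ (P i) = 0) {q : ℝ[X]} (hq : q.degree < N) : φ q = 0 := by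
  induction N generalizing q with
  | zero =>
    have : q = 0 := by
      rw [← degree_eq_bot]
      exact Nat.WithBot.lt_zero_iff.mp (by simpa using hq)
    simp [this]
  | succ d ih =>
    have h1 : (q - C (q.coeff d) * P d).degree < (d : WithBot ℕ) := by
      rw [degree_lt_iff_coeff_zero] at hq ⊢
      intro m hm
      rw [coeff_sub, coeff_C_mul]
      rcases Nat.eq_or_lt_of_le hm with h | h
      · subst h
        have : (P d).coeff d = 1 := by
          have := (hP.monic d).coeff_natDegree
          rwa [hP.natDegree_eq] at this
        rw [this, mul_one, sub_self]
      · rw [hq m h, coeff_eq_zero_of_natDegree_lt (p := P d) (by rwa [hP.natDegree_eq]),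
          mul_zero, sub_self]
    have h2 := ih (fun i hi => h i (by omega)) h1
    rwa [← smul_eq_C_mul, map_sub, map_smul, h d (by omega), smul_zero, sub_zero] at h2

theorem apply_eq_zero_of_degree_lt (hP : IsMonicOrthogonalSeq B P) {N : ℕ} {q : ℝ[X]}
    (hq : q.degree < N) : B (P N) q = 0 :=
  hP.linearMap_eq_zero (φ := B (P N)) (fun i hi => hP.orthogonal N i (by omega)) hq

/-- A monic polynomial of degree `N` orthogonal to all polynomials of smaller degree is `P N`. -/
theorem eq_of_orthogonal (hP : IsMonicOrthogonalSeq B P) (hpos : ∀ p, p ≠ 0 → 0 < B p p)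
    {N : ℕ} {p : ℝ[X]} (hp : p.Monic) (hdeg : p.natDegree = N)
    (horth : ∀ q : ℝ[X], q.degree < N → B p q = 0) : p = P N := by
  have hlt : (p - P N).degree < N := by
    have hN := hP.monic N
    have h1 : p.degree = N := by rw [degree_eq_natDegree hp.ne_zero, hdeg]
    have h2 : (P N).degree = N := by rw [degree_eq_natDegree hN.ne_zero, hP.natDegree_eq]
    rw [← h1]
    exact degree_sub_lt_left (h1.trans h2.symm) hp.ne_zero (by rw [hp.leadingCoeff, hN.leadingCoeff])
  by_contra hne
  have := hpos _ (sub_ne_zero.mpr hne)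
  rw [LinearMap.map_sub₂, horth _ hlt, hP.apply_eq_zero_of_degree_lt hlt] at this
  simp at this

end IsMonicOrthogonalSeq

theorem freudInner_comp_neg_X (p q : ℝ[X]) :
    freudInner (p.comp (-X)) (q.comp (-X)) = freudInner p q := by
  rw [freudInner_apply, freudInner_apply, ← integral_neg_eq_self]
  simp [eval_comp, Even.neg_pow (by decide : Even 4)]

theorem freudPoly_comp_neg_X (m : ℕ) :
    (freudPoly m).comp (-X) = C ((-1) ^ m) * freudPoly m := by
  have hF := isMonicOrthogonalSeq_freudPoly
  have hsq : ((-1 : ℝ) ^ m) * (-1) ^ m = 1 := by rw [← mul_pow]; simp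
  have h := hF.eq_of_orthogonal freudInner_self_pos (N := m)
    (p := C ((-1) ^ m) * (freudPoly m).comp (-X)) (by
      have h := (hF.monic m).neg_one_pow_natDegree_mul_comp_neg_X
      rw [hF.natDegree_eq] at h
      simpa using h)
    (by rw [natDegree_C_mul (pow_ne_zero _ (by norm_num)), natDegree_comp, natDegree_neg,
      natDegree_X, mul_one, hF.natDegree_eq])
    (fun q hq => by
      rw [← smul_eq_C_mul, map_smul, LinearMap.smul_apply, ← comp_neg_X_comp_neg_X q,
        freudInner_comp_neg_X, hF.apply_eq_zero_of_degree_lt (by rwa [degree_comp_neg_X]),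
        smul_zero])
  rw [← congrArg (C ((-1) ^ m) * ·) h, ← mul_assoc, ← C_mul, hsq, C_1, one_mul]

/-- An odd polynomial has the form `x f(x²)`. -/
theorem exists_eq_X_mul_expand {p : ℝ[X]} (hp : p.comp (-X) = -p) :
    ∃ f : ℝ[X], p = X * expand ℝ 2 f := by
  have hcoeff : ∀ m, Even m → p.coeff m = 0 := by
    intro m hm
    have h := congrArg (fun q => q.coeff m) hp
    simp only [coeff_neg] at h
    rw [show (-X : ℝ[X]) = C (-1) * X by simp, comp_C_mul_X_coeff, hm.neg_one_pow] at h
    linarith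
  refine ⟨contract 2 (divX p), ?_⟩
  ext m
  cases m with
  | zero => simp [hcoeff 0]
  | succ m =>
    rw [coeff_X_mul, coeff_expand two_pos]
    split_ifs with h
    · rw [coeff_contract two_ne_zero, Nat.div_mul_cancel h, coeff_divX]
    · refine hcoeff _ ?_
      rw [← even_iff_two_dvd] at h
      exact Nat.even_add_one.mpr h

theorem expand_two_ne_zero {p : ℝ[X]} (hp : p ≠ 0) : expand ℝ 2 p ≠ 0 :=
  (expand_ne_zero two_pos).mpr hp

theorem natDegree_X_mul_expand {p : ℝ[X]} (hp : p ≠ 0) :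
    (X * expand ℝ 2 p).natDegree = 2 * p.natDegree + 1 := by
  rw [natDegree_X_mul (expand_two_ne_zero hp), natDegree_expand, mul_comm]

theorem degree_X_mul_expand_lt {p : ℝ[X]} {n : ℕ} :
    (X * expand ℝ 2 p).degree < ((2 * n : ℕ) : WithBot ℕ) ↔ p.degree < n := by
  by_cases hp : p = 0
  · rw [hp, map_zero, mul_zero, degree_zero]
    exact ⟨fun _ => WithBot.bot_lt_coe _, fun _ => WithBot.bot_lt_coe _⟩
  · rw [degree_eq_natDegree hp,
      degree_eq_natDegree (mul_ne_zero X_ne_zero (expand_two_ne_zero hp)),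
      natDegree_X_mul_expand hp]
    norm_cast
    omega

theorem eval_X_mul_expand (p : ℝ[X]) (x : ℝ) :
    (X * expand ℝ 2 p).eval x = x * p.eval (x ^ 2) := by
  rw [eval_mul, eval_X, expand_eval]

theorem eval_derivative_X_mul_expand (p : ℝ[X]) (x : ℝ) :
    (derivative (X * expand ℝ 2 p)).eval x =
      p.eval (x ^ 2) + 2 * x ^ 2 * (derivative p).eval (x ^ 2) := by
  rw [derivative_mul, derivative_X, one_mul, derivative_expand]
  simp only [eval_add, eval_mul, eval_X, expand_eval, eval_pow, eval_natCast]
  push_cast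
  ring

theorem eval_zero_derivative_X_mul_expand (p : ℝ[X]) :
    (derivative (X * expand ℝ 2 p)).eval 0 = p.eval 0 := by
  rw [eval_derivative_X_mul_expand]; simp

theorem eval_zero_derivative_three_X_mul_expand (p : ℝ[X]) :
    (derivative^[3] (X * expand ℝ 2 p)).eval 0 = 6 * (derivative p).eval 0 := by
  have h : (expand ℝ 2 p).coeff 2 = p.coeff 1 := coeff_expand_mul two_pos p 1
  rw [← coeff_zero_eq_eval_zero, ← coeff_zero_eq_eval_zero, coeff_iterate_derivative,
    coeff_derivative, coeff_X_mul, h]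
  simp [Nat.descFactorial]

/-- The functional `∫ x² p(x²) e^{-x⁴} dx`, which governs the odd Freud polynomials in the
variable `x²`. -/
def freudHalf : ℝ[X] →ₗ[ℝ] ℝ :=
  freudInner X ∘ₗ LinearMap.mulLeft ℝ X ∘ₗ (expand ℝ 2).toLinearMap

theorem freudHalf_mul (p q : ℝ[X]) :
    freudHalf (p * q) = freudInner (X * expand ℝ 2 p) (X * expand ℝ 2 q) := by
  simp only [freudHalf, LinearMap.comp_apply, LinearMap.mulLeft_apply, AlgHom.toLinearMap_apply,
    freudInner_apply, map_mul, eval_mul, eval_X]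
  congr 1
  funext x
  ring

theorem isHalfLinePositive_freudHalf : IsHalfLinePositive freudHalf where
  mul_self_pos p hp := by
    rw [freudHalf_mul]
    exact freudInner_self_pos _ (mul_ne_zero X_ne_zero (expand_two_ne_zero hp))
  X_mul_self_pos p hp := by
    have h := freudInner_self_pos (X ^ 2 * expand ℝ 2 p)
      (mul_ne_zero (pow_ne_zero _ X_ne_zero) (expand_two_ne_zero hp))
    convert h using 1
    rw [freudHalf_mul, freudInner_apply, freudInner_apply]
    simp only [map_mul, eval_mul, eval_X, expand_X, eval_pow]
    congr 1
    funext x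
    ring

theorem freudPoly_odd_comp_neg_X (n : ℕ) :
    (freudPoly (2 * n + 1)).comp (-X) = -freudPoly (2 * n + 1) := by
  rw [freudPoly_comp_neg_X, (odd_two_mul_add_one n).neg_one_pow]
  simp

theorem eval_zero_derivative_freudPoly_of_even {m : ℕ} (hm : Even m) :
    (derivative (freudPoly m)).eval 0 = 0 := by
  have h := congrArg (fun q => (derivative q).eval 0) (freudPoly_comp_neg_X m)
  simp only [hm.neg_one_pow, C_1, one_mul, derivative_comp] at h
  simp only [derivative_neg, derivative_X, eval_mul, eval_comp, eval_neg, eval_one, eval_X,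
    neg_zero] at h
  linarith

/-! ### The reproducing kernel and the Freud–Sobolev polynomials -/

theorem freudKernelDeriv_zero_one (n : ℕ) :
    freudKernelDeriv (2 * n - 1) 0 1 0 = ∑ i ∈ Finset.range (2 * n - 1 + 1),
      C ((derivative (freudPoly i)).eval 0 / freudInner (freudPoly i) (freudPoly i)) *
        freudPoly i := rfl

theorem freudKernelDeriv_comp_neg_X (n : ℕ) :
    (freudKernelDeriv (2 * n - 1) 0 1 0).comp (-X) = -freudKernelDeriv (2 * n - 1) 0 1 0 := by
  rw [freudKernelDeriv_zero_one, Polynomial.sum_comp, ← Finset.sum_neg_distrib]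
  refine Finset.sum_congr rfl fun i _ => ?_
  rw [mul_comp, C_comp, freudPoly_comp_neg_X]
  rcases Nat.even_or_odd i with h | h
  · simp [eval_zero_derivative_freudPoly_of_even h]
  · simp [h.neg_one_pow]

theorem degree_freudKernelDeriv_lt {n : ℕ} (hn : 1 ≤ n) :
    (freudKernelDeriv (2 * n - 1) 0 1 0).degree < ((2 * n : ℕ) : WithBot ℕ) := by
  rw [freudKernelDeriv_zero_one]
  refine (degree_sum_le _ _).trans_lt ((Finset.sup_lt_iff (WithBot.bot_lt_coe _)).mpr ?_)
  intro i hi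
  rw [Finset.mem_range] at hi
  rw [← smul_eq_C_mul]
  refine (degree_smul_le _ _).trans_lt ?_
  rw [degree_eq_natDegree (isMonicOrthogonalSeq_freudPoly.monic i).ne_zero,
    isMonicOrthogonalSeq_freudPoly.natDegree_eq]
  exact_mod_cast (by omega : i < 2 * n)

theorem freudK11_eq (n : ℕ) :
    freudK11 n = (derivative (freudKernelDeriv (2 * n - 1) 0 1 0)).eval 0 := by
  simp [freudK11, freudKernelDeriv]

/-- `K_{2n-1}^{(0,1)}(·, 0)` represents `q ↦ q'(0)` on polynomials of degree at most `2n`; degree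
`2n` is included because `F_{2n}'(0) = 0`. -/
theorem freudInner_freudKernelDeriv {n : ℕ} (hn : 1 ≤ n) {q : ℝ[X]}
    (hq : q.degree < ((2 * n + 1 : ℕ) : WithBot ℕ)) :
    freudInner (freudKernelDeriv (2 * n - 1) 0 1 0) q = (derivative q).eval 0 := by
  have hF := isMonicOrthogonalSeq_freudPoly
  let φ : ℝ[X] →ₗ[ℝ] ℝ :=
    freudInner (freudKernelDeriv (2 * n - 1) 0 1 0) - leval 0 ∘ₗ derivative
  suffices h : φ q = 0 by
    simpa [φ, sub_eq_zero] using h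
  refine hF.linearMap_eq_zero (fun i hi => ?_) hq
  simp only [φ, LinearMap.sub_apply, LinearMap.comp_apply, leval_apply, sub_eq_zero]
  rcases Nat.lt_or_eq_of_le (Nat.le_of_lt_succ hi) with h | rfl
  · rw [freudKernelDeriv_zero_one]
    simp only [map_sum, LinearMap.sum_apply, ← smul_eq_C_mul, map_smul, LinearMap.smul_apply,
      smul_eq_mul]
    rw [Finset.sum_eq_single i]
    · rw [div_mul_cancel₀ _ (hF.norm_ne_zero i)]
    · intro k _ hk
      rw [hF.orthogonal k i hk, mul_zero]
    · intro hni
      exact absurd (Finset.mem_range.mpr (by omega)) hni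
  · rw [freudInner_comm, hF.apply_eq_zero_of_degree_lt (degree_freudKernelDeriv_lt hn),
      eval_zero_derivative_freudPoly_of_even (even_two_mul n)]

/-- `Q_{2n+1}` differs from `F_{2n+1}` by a multiple of the kernel, and does not depend on `M₀`
because it is odd. -/
theorem freudSobolevPoly_odd_eq {n : ℕ} (hn : 1 ≤ n) {M₀ M : ℝ} (h₀ : 0 ≤ M₀) (hM : 0 ≤ M)
    (hK : 0 < freudK11 n) :
    freudSobolevPoly M₀ M (2 * n + 1) = freudPoly (2 * n + 1) -
      C (M * (derivative (freudPoly (2 * n + 1))).eval 0 / (1 + M * freudK11 n)) *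
        freudKernelDeriv (2 * n - 1) 0 1 0 := by
  have hF := isMonicOrthogonalSeq_freudPoly
  have hden : 1 + M * freudK11 n ≠ 0 := by positivity
  set F := freudPoly (2 * n + 1) with hFdef
  set κ := freudKernelDeriv (2 * n - 1) 0 1 0 with hκ
  set c := M * (derivative F).eval 0 / (1 + M * freudK11 n) with hc
  have hFdeg : F.degree = (2 * n + 1 : ℕ) := by
    rw [degree_eq_natDegree (hF.monic _).ne_zero, hF.natDegree_eq]
  have hlt : (C c * κ).degree < F.degree := by
    rw [hFdeg, ← smul_eq_C_mul]
    refine (degree_smul_le _ _).trans_lt ((degree_freudKernelDeriv_lt hn).trans ?_)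
    exact_mod_cast Nat.lt_succ_self _
  have hQ0 : (F - C c * κ).eval 0 = 0 := by
    have hodd : (F - C c * κ).comp (-X) = -(F - C c * κ) := by
      rw [sub_comp, mul_comp, C_comp, freudPoly_odd_comp_neg_X, freudKernelDeriv_comp_neg_X]
      ring
    have := congrArg (eval 0) hodd
    simp only [eval_comp, eval_neg, eval_X, neg_zero] at this
    linarith
  have hQ1 : (derivative (F - C c * κ)).eval 0 = c / M ∨ M = 0 := by
    rcases eq_or_ne M 0 with h | h
    · exact Or.inr h
    · left
      rw [derivative_sub, derivative_C_mul, eval_sub, eval_mul, eval_C, ← freudK11_eq, hc]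
      field_simp
      ring
  refine ((isMonicOrthogonalSeq_freudSobolevPoly h₀ hM).eq_of_orthogonal (fun p hp => ?_)
    ((hF.monic _).sub_of_left hlt) ?_ fun q hq => ?_).symm
  · rw [freudSobolevInner_apply]
    have h1 := freudInner_self_pos p hp
    have h2 := mul_nonneg h₀ (mul_self_nonneg (p.eval 0))
    have h3 := mul_nonneg hM (mul_self_nonneg ((derivative p).eval 0))
    linarith
  · rw [natDegree_eq_of_degree_eq (degree_sub_eq_left_of_degree_lt hlt), hF.natDegree_eq]
  · rw [freudSobolevInner_apply, hQ0, map_sub, LinearMap.sub_apply,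
      hF.apply_eq_zero_of_degree_lt hq, ← smul_eq_C_mul, map_smul, LinearMap.smul_apply,
      freudInner_freudKernelDeriv hn hq, smul_eq_C_mul]
    rcases hQ1 with h | h
    · rw [h, smul_eq_mul]
      rcases eq_or_ne M 0 with h0 | h0
      · simp [hc, h0]
      · field_simp
        ring
    · simp [hc, h]

/-- The Freud polynomial `F_{2n+1}` and the kernel in the variable `x²`. -/
theorem exists_freud_half {n : ℕ} (hn : 1 ≤ n) :
    ∃ f k : ℝ[X], freudPoly (2 * n + 1) = X * expand ℝ 2 f ∧
      freudKernelDeriv (2 * n - 1) 0 1 0 = X * expand ℝ 2 k ∧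
      f.Monic ∧ f.natDegree = n ∧ (∀ q : ℝ[X], q.degree < n → freudHalf (f * q) = 0) ∧
      k.degree < n ∧ ∀ q : ℝ[X], q.degree < n → freudHalf (k * q) = q.eval 0 := by
  have hF := isMonicOrthogonalSeq_freudPoly
  obtain ⟨f, hf⟩ := exists_eq_X_mul_expand (freudPoly_odd_comp_neg_X n)
  obtain ⟨k, hk⟩ := exists_eq_X_mul_expand (freudKernelDeriv_comp_neg_X n)
  have hlt : ∀ q : ℝ[X], q.degree < n → (X * expand ℝ 2 q).degree < ((2 * n + 1 : ℕ) : WithBot ℕ) :=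
    fun q hq => (degree_X_mul_expand_lt.mpr hq).trans (by exact_mod_cast Nat.lt_succ_self _)
  have hfm : f.Monic := by
    have h := hF.monic (2 * n + 1)
    rw [hf] at h
    exact (monic_expand_iff two_pos).mp (monic_X.of_mul_monic_left h)
  refine ⟨f, k, hf, hk, hfm, ?_, fun q hq => ?_, ?_, fun q hq => ?_⟩
  · have h := hF.natDegree_eq (2 * n + 1)
    rw [hf, natDegree_X_mul_expand hfm.ne_zero] at h
    omega
  · rw [freudHalf_mul, ← hf, hF.apply_eq_zero_of_degree_lt (hlt q hq)]
  · rw [← degree_X_mul_expand_lt, ← hk]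
    exact degree_freudKernelDeriv_lt hn
  · rw [freudHalf_mul, ← hk, freudInner_freudKernelDeriv hn (hlt q hq),
      eval_zero_derivative_X_mul_expand]


/-! ### From the variable `x²` back to `x` -/

theorem isIncreasingList_sqrt {n : ℕ} {v : ℕ → ℝ} {S : Set ℝ} (hv : StrictMonoOn v (Set.Icc 1 n))
    (hpos : ∀ k, 1 ≤ k → k ≤ n → 0 ≤ v k)
    (hS : ∀ x, x ∈ S ↔ 0 ≤ x ∧ ∃ k, 1 ≤ k ∧ k ≤ n ∧ v k = x ^ 2) :
    IsIncreasingList n (fun k => √(v k)) S := by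
  refine ⟨fun i hi k hk hik => Real.sqrt_lt_sqrt (hpos i hi.1 hi.2) (hv hi hk hik), ?_⟩
  ext x
  rw [hS]
  constructor
  · rintro ⟨k, hk, rfl⟩
    exact ⟨Real.sqrt_nonneg _, k, hk.1, hk.2, (Real.sq_sqrt (hpos k hk.1 hk.2)).symm⟩
  · rintro ⟨hx, k, hk, hkn, h⟩
    exact ⟨k, ⟨hk, hkn⟩, by simp only [h, Real.sqrt_sq hx]⟩

theorem isIncreasingList_sqrt_pos {n : ℕ} {v : ℕ → ℝ} {p f : ℝ[X]}
    (hv : StrictMonoOn v (Set.Icc 1 n)) (hpos : ∀ k, 1 ≤ k → k ≤ n → 0 < v k)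
    (hp : p = X * expand ℝ 2 f)
    (hf : ∀ u, f.eval u = 0 ↔ ∃ k, 1 ≤ k ∧ k ≤ n ∧ v k = u) :
    IsIncreasingList n (fun k => √(v k)) {x | 0 < x ∧ p.IsRoot x} := by
  refine isIncreasingList_sqrt hv (fun k hk hkn => (hpos k hk hkn).le) fun x => ?_
  rw [Set.mem_ofPred_eq, IsRoot, hp, eval_X_mul_expand, mul_eq_zero, ← hf]
  constructor
  · rintro ⟨hx, h⟩
    exact ⟨hx.le, h.resolve_left hx.ne'⟩
  · rintro ⟨hx, h⟩
    refine ⟨lt_of_le_of_ne hx ?_, Or.inr h⟩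
    rintro rfl
    obtain ⟨k, hk, hkn, h⟩ := (hf _).mp h
    exact (hpos k hk hkn).ne' (by simpa using h)

theorem tendsto_mul_div_one_add_mul {a K : ℝ} (hK : 0 < K) :
    Tendsto (fun M : ℝ => M * a / (1 + M * K)) atTop (𝓝 (a / K)) := by
  have h : Tendsto (fun M : ℝ => a / (M⁻¹ + K)) atTop (𝓝 (a / (0 + K))) :=
    tendsto_const_nhds.div (tendsto_inv_atTop_zero.add tendsto_const_nhds) (by linarith)
  rw [zero_add] at h
  refine h.congr' ?_
  filter_upwards [eventually_gt_atTop 0] with M hM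
  field_simp

/-- First-order asymptotics of square roots, given those of the squares. -/
theorem tendsto_mul_sqrt_sub_sqrt {r : ℝ → ℝ} {s a : ℝ} (hs : 0 < s)
    (hr : Tendsto r atTop (𝓝 s)) (h : Tendsto (fun M => M * (r M - s)) atTop (𝓝 a)) :
    Tendsto (fun M => M * (√(r M) - √s)) atTop (𝓝 (a / (2 * √s))) := by
  have hs' := Real.sqrt_pos.mpr hs
  have h1 : Tendsto (fun M => √(r M) + √s) atTop (𝓝 (2 * √s)) := by
    rw [two_mul]
    exact ((Real.continuous_sqrt.tendsto s).comp hr).add tendsto_const_nhds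
  refine (h.div h1 (by positivity)).congr' ?_
  filter_upwards [hr.eventually (lt_mem_nhds hs)] with M hM
  have hsum : √(r M) + √s ≠ 0 := by positivity
  rw [Pi.div_apply, div_eq_iff hsum]
  linear_combination (-M) * Real.sq_sqrt hM.le + M * Real.sq_sqrt hs.le

theorem mainTheorem1 (n : ℕ) (hn : 1 ≤ n) (M₀ : ℝ) (hM₀ : 0 ≤ M₀) :
    -- `J_{2n+1}` is the limit of `Q_{2n+1}` as `M₁ → ∞`
    (∀ i : ℕ, Tendsto (fun M₁ : ℝ => (freudSobolevPoly M₀ M₁ (2 * n + 1)).coeff i) atTop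
      (𝓝 ((freudLimitPoly n).coeff i))) ∧
    ∃ (x y : ℕ → ℝ) (η : ℝ → ℕ → ℝ),
      -- the zeros of `F_{2n+1}`, `J_{2n+1}` and `Q_{2n+1}` on the half-line, in increasing order
      IsIncreasingList n x {t | 0 < t ∧ (freudPoly (2 * n + 1)).IsRoot t} ∧
      IsIncreasingList n y {t | 0 ≤ t ∧ (freudLimitPoly n).IsRoot t} ∧
      (∀ M₁, 0 ≤ M₁ →
        IsIncreasingList n (η M₁) {t | 0 < t ∧ (freudSobolevPoly M₀ M₁ (2 * n + 1)).IsRoot t}) ∧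
      -- interlacing
      y 1 = 0 ∧
      (∀ M₁, 0 < M₁ → ∀ k, 1 ≤ k → k ≤ n → y k < η M₁ k ∧ η M₁ k < x k) ∧
      (∀ k, 1 ≤ k → k < n → x k < y (k + 1)) ∧
      -- monotonicity in `M₁`
      (∀ k, 1 ≤ k → k ≤ n → StrictAntiOn (fun M₁ => η M₁ k) (Set.Ici 0)) ∧
      -- convergence
      (∀ k, 1 ≤ k → k ≤ n → Tendsto (fun M₁ => η M₁ k) atTop (𝓝 (y k))) ∧
      -- rate of convergence for `k ≥ 2`
      (∀ k, 2 ≤ k → k ≤ n →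
        freudK11 n * (derivative (freudLimitPoly n)).eval (y k) ≠ 0 ∧
        Tendsto (fun M₁ => M₁ * (η M₁ k - y k)) atTop
          (𝓝 (-(freudPoly (2 * n + 1)).eval (y k) /
            (freudK11 n * (derivative (freudLimitPoly n)).eval (y k))))) ∧
      -- rate of convergence for `k = 1`, where the quotient above is of the form `0 / 0`
      freudK11 n * (derivative^[3] (freudLimitPoly n)).eval 0 ≠ 0 ∧
      Tendsto (fun M₁ => M₁ * η M₁ 1 ^ 2) atTop
        (𝓝 (-(6 * (derivative (freudPoly (2 * n + 1))).eval 0) /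
          (freudK11 n * (derivative^[3] (freudLimitPoly n)).eval 0))) ∧
      Tendsto (fun M₁ => M₁ * (η M₁ 1 - y 1)) atTop atTop := by
  obtain ⟨f, k, hF, hκ, hfm, hfdeg, hforth, hkdeg, hkrep⟩ := exists_freud_half hn
  obtain ⟨s, t, hst, hs1, hft, hjs⟩ :=
    isHalfLinePositive_freudHalf.exists_interlace hn hfm hfdeg hforth hkdeg hkrep
  have hk0 := isHalfLinePositive_freudHalf.kernel_eval_zero_pos hn hkdeg hkrep
  have hK : freudK11 n = k.eval 0 := by
    rw [freudK11_eq, hκ, eval_zero_derivative_X_mul_expand]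
  have hKpos : 0 < freudK11 n := hK ▸ hk0
  have hF0 : (derivative (freudPoly (2 * n + 1))).eval 0 = f.eval 0 := by
    rw [hF, eval_zero_derivative_X_mul_expand]
  set j := Lagrange.nodal (Finset.Icc 1 n) s with hj
  have hJ : freudLimitPoly n = X * expand ℝ 2 j := by
    rw [freudLimitPoly, hF0, hK, hF, hκ, ← hjs, map_sub, map_mul, expand_C]
    ring
  -- up to a constant factor, `Q_{2n+1}` is the pencil with parameter `M K^{(1,1)}(0,0)` at `x²`
  have hQ : ∀ M, 0 ≤ M → C (1 + M * freudK11 n) * freudSobolevPoly M₀ M (2 * n + 1) =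
      X * expand ℝ 2 (Interlace.pencil n s t (M * freudK11 n)) := by
    intro M hM
    have hden : 1 + M * freudK11 n ≠ 0 := by positivity
    have h1 : C (1 + M * freudK11 n) * C (M * f.eval 0 / (1 + M * freudK11 n)) =
        C (M * freudK11 n) * C (f.eval 0 / freudK11 n) := by
      rw [← C_mul, ← C_mul]
      congr 1
      field_simp
    have h2 : C (1 + M * freudK11 n) = 1 + C (M * freudK11 n) := by rw [C_add, C_1]
    rw [freudSobolevPoly_odd_eq hn hM₀ hM hKpos, hF0, mul_sub, ← mul_assoc, h1, h2, hF, hκ,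
      Interlace.pencil, ← hft, ← hj, ← hjs, ← hK]
    simp only [map_add, map_sub, map_mul (expand ℝ 2), expand_C]
    ring
  have hspos : ∀ i, 1 ≤ i → i ≤ n → 0 ≤ s i := fun i hi hin => by
    rw [← hs1]
    exact hst.strictMonoOn_left.monotoneOn ⟨le_rfl, hn⟩ ⟨hi, hin⟩ hi
  have htpos : ∀ i, 1 ≤ i → i ≤ n → 0 < t i := fun i hi hin =>
    (hspos i hi hin).trans_lt (hst.lt i hi hin)
  set r : ℝ → ℕ → ℝ := fun M => Interlace.pencilRoot n s t (M * freudK11 n) with hr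
  have hrspec := fun M (hM : 0 ≤ M) i (hi : 1 ≤ i) (hin : i ≤ n) =>
    hst.pencilRoot_spec (mul_nonneg hM hKpos.le) hi hin
  have hrpos : ∀ M, 0 ≤ M → ∀ i, 1 ≤ i → i ≤ n → 0 < r M i := fun M hM i hi hin =>
    (hspos i hi hin).trans_lt (hrspec M hM i hi hin).1
  have htop : Tendsto (fun M => M * freudK11 n) atTop atTop :=
    tendsto_id.atTop_mul_const hKpos
  have hrlim : ∀ i, 1 ≤ i → i ≤ n → Tendsto (fun M => r M i) atTop (𝓝 (s i)) :=
    fun i hi hin => (hst.tendsto_pencilRoot hi hin).comp htop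
  have hrate : ∀ i, 1 ≤ i → i ≤ n → Tendsto (fun M => M * (r M i - s i)) atTop
      (𝓝 (-f.eval (s i) / (derivative j).eval (s i) / freudK11 n)) := by
    intro i hi hin
    have h := ((hst.tendsto_mul_pencilRoot_sub hi hin).comp htop).div_const (freudK11 n)
    rw [← hft, ← hj] at h
    refine h.congr fun M => ?_
    simp only [Function.comp_apply, hr]
    field_simp
  have hj' : ∀ i, 1 ≤ i → i ≤ n → 0 < (-1) ^ (n - i) * (derivative j).eval (s i) := by
    intro i hi hin
    rw [hj, Lagrange.eval_nodal_derivative_eval_node_eq (Finset.mem_Icc.mpr ⟨hi, hin⟩)]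
    exact Lagrange.sign_eval_nodal_erase hst.strictMonoOn_left hi hin
  have hj'ne : ∀ i, 1 ≤ i → i ≤ n → (derivative j).eval (s i) ≠ 0 := fun i hi hin h0 => by
    have := hj' i hi hin
    rw [h0, mul_zero] at this
    exact lt_irrefl _ this
  have hy1 : √(s 1) = 0 := by rw [hs1, Real.sqrt_zero]
  have hJ3 : (derivative^[3] (freudLimitPoly n)).eval 0 = 6 * (derivative j).eval (s 1) := by
    rw [hJ, eval_zero_derivative_three_X_mul_expand, hs1]
  -- the rate for the smallest zero, in the variable `x²`
  have hrate1 : Tendsto (fun M => M * √(r M 1) ^ 2) atTop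
      (𝓝 (-f.eval (s 1) / (derivative j).eval (s 1) / freudK11 n)) := by
    refine (hrate 1 le_rfl hn).congr' ?_
    filter_upwards [eventually_ge_atTop 0] with M hM
    rw [Real.sq_sqrt (hrpos M hM 1 le_rfl hn).le, hs1, sub_zero]
  refine ⟨fun i => ?_, fun i => √(t i), fun i => √(s i), fun M i => √(r M i),
    ?_, ?_, fun M hM => ?_, hy1, fun M hM i hi hin => ⟨?_, ?_⟩, fun i hi hin => ?_,
    fun i hi hin => ?_, fun i hi hin => ?_, fun i hi hin => ?_, ?_, ?_, ?_⟩
  · have h := ((tendsto_mul_div_one_add_mul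
      (a := (derivative (freudPoly (2 * n + 1))).eval 0) hKpos).mul_const
      ((freudKernelDeriv (2 * n - 1) 0 1 0).coeff i)).const_sub
      ((freudPoly (2 * n + 1)).coeff i)
    rw [freudLimitPoly, coeff_sub, coeff_C_mul]
    refine h.congr' ?_
    filter_upwards [eventually_ge_atTop 0] with M hM
    rw [freudSobolevPoly_odd_eq hn hM₀ hM hKpos, coeff_sub, coeff_C_mul]
  · exact isIncreasingList_sqrt_pos hst.strictMonoOn_right htpos hF fun u => by
      rw [hft, Lagrange.eval_nodal_eq_zero_iff]
  · refine isIncreasingList_sqrt hst.strictMonoOn_left hspos fun x => ?_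
    rw [Set.mem_ofPred_eq, IsRoot, hJ, eval_X_mul_expand, mul_eq_zero, hj,
      ← Lagrange.eval_nodal_eq_zero_iff]
    refine and_congr_right fun _ => or_iff_right_of_imp ?_
    rintro rfl
    exact Lagrange.eval_nodal_eq_zero_iff.mpr ⟨1, le_rfl, hn, by simp [hs1]⟩
  · have hden : 1 + M * freudK11 n ≠ 0 := by positivity
    have hset : {t | 0 < t ∧ (freudSobolevPoly M₀ M (2 * n + 1)).IsRoot t} =
        {t | 0 < t ∧ (C (1 + M * freudK11 n) * freudSobolevPoly M₀ M (2 * n + 1)).IsRoot t} := by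
      ext t
      simp [IsRoot, hden]
    rw [hset]
    exact isIncreasingList_sqrt_pos (hst.strictMonoOn_pencilRoot (mul_nonneg hM hKpos.le))
      (hrpos M hM) (hQ M hM) fun u => hst.eval_pencil_eq_zero_iff (mul_nonneg hM hKpos.le)
  · exact Real.sqrt_lt_sqrt (hspos i hi hin) (hrspec M hM.le i hi hin).1
  · exact Real.sqrt_lt_sqrt (hrpos M hM.le i hi hin).le
      ((hrspec M hM.le i hi hin).2.2.1 (mul_pos hM hKpos))
  · exact Real.sqrt_lt_sqrt (htpos i hi hin.le).le (hst.lt_succ i hi hin)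
  · intro M hM M' hM' hlt
    exact Real.sqrt_lt_sqrt (hrpos M' hM' i hi hin).le
      (hst.strictAntiOn_pencilRoot hi hin (mul_nonneg hM hKpos.le) (mul_nonneg hM' hKpos.le)
        (mul_lt_mul_of_pos_right hlt hKpos))
  · exact (Real.continuous_sqrt.tendsto _).comp (hrlim i hi hin)
  · have hi1 : 1 ≤ i := by omega
    have hsi : 0 < s i := by
      rw [← hs1]
      exact hst.strictMonoOn_left ⟨le_rfl, hn⟩ ⟨hi1, hin⟩ (by omega)
    have hsq := Real.sq_sqrt hsi.le
    have hsqrt := Real.sqrt_pos.mpr hsi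
    have hJ' : (derivative (freudLimitPoly n)).eval √(s i) =
        2 * √(s i) ^ 2 * (derivative j).eval (s i) := by
      rw [hJ, eval_derivative_X_mul_expand, hsq, hj,
        Lagrange.eval_nodal_at_node (Finset.mem_Icc.mpr ⟨hi1, hin⟩), zero_add]
    have hne := hj'ne i hi1 hin
    refine ⟨?_, ?_⟩
    · rw [hJ']
      positivity
    · have h := tendsto_mul_sqrt_sub_sqrt hsi (hrlim i hi1 hin) (hrate i hi1 hin)
      convert h using 2
      rw [hJ', hF, eval_X_mul_expand, hsq]
      field_simp
      rw [hsq]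
      ring
  · rw [hJ3]
    exact mul_ne_zero hKpos.ne' (mul_ne_zero (by norm_num) (hj'ne 1 le_rfl hn))
  · convert hrate1 using 2
    have hne := hj'ne 1 le_rfl hn
    rw [hJ3, hF0, hs1]
    rw [hs1] at hne
    field_simp
  · -- `M η` is `M η²`, which has a positive limit, divided by `η → 0⁺`
    have hpos : 0 < -f.eval (s 1) / (derivative j).eval (s 1) / freudK11 n := by
      refine div_pos ?_ hKpos
      have h1 := hst.sign_right le_rfl hn
      rw [← hft] at h1
      have h2 := hj' 1 le_rfl hn
      have h3 : -f.eval (s 1) / (derivative j).eval (s 1) =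
          -((-1) ^ (n - 1) * f.eval (s 1)) / ((-1) ^ (n - 1) * (derivative j).eval (s 1)) := by
        rw [neg_div, neg_div, mul_div_mul_left _ _ (pow_ne_zero _ (by norm_num))]
      rw [h3]
      exact div_pos (by linarith) h2
    have h0 : Tendsto (fun M => √(r M 1)) atTop (𝓝[>] 0) := by
      refine tendsto_nhdsWithin_iff.mpr ⟨?_, ?_⟩
      · rw [← hy1]
        exact (Real.continuous_sqrt.tendsto _).comp (hrlim 1 le_rfl hn)
      · filter_upwards [eventually_ge_atTop 0] with M hM
        exact Real.sqrt_pos.mpr (hrpos M hM 1 le_rfl hn)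
    refine (hrate1.pos_mul_atTop hpos (tendsto_inv_nhdsGT_zero.comp h0)).congr' ?_
    filter_upwards [eventually_ge_atTop 0] with M hM
    have hne := (Real.sqrt_pos.mpr (hrpos M hM 1 le_rfl hn)).ne'
    simp only [Function.comp_apply, hy1, sub_zero]
    field_simp

end
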